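/- **Conventions.** Let $d\ge 1$ and $\mathcal H_A=\mathbb C^d$ with standard basis $|1\rangle,\dots,|d\rangle$. - $\mathbb M$ is the linear isomorphism $\mathcal H_A\otimes\mathcal H_A\to M_d(\mathbb C)$, $\sum_{i,j}M_{ij}|i\rangle|j\rangle\mapsto (M_{ij})$. - $\mathbb F$ is the flip: it swaps the two tensor factors and takes the complex conjugate, so that $\mathbb M(\mathbb F\psi)=\mathbb M(\psi)^\dagger$. - $X$ is the $d\times d$ matrix with ones on the anti-diagonal and zeros elsewhere. - For a subspace $S\subseteq\mathcal H_A\otimes\mathcal H_A$ and $k\ge1$, $S^{\otimes k}$ is regarded as a subspace of $\mathcal H_A^{\otimes k}\otimes\mathcal H_A^{\otimes k}$ by collecting all first and all second tensor factors. $S$ is *strongly unextendible* if for every $k\ge 1$ there are no nonzero $\psi,\varphi\in\mathcal H_A^{\otimes k}$ with $\psi\otimes\varphi\in (S^{\otimes k})^\perp$. - A *channel* is a completely positive trace-preserving linear map between full matrix algebras. The zero-error classical capacity $C_0(\mathcal E)$ is the supremum of $\frac1k\log_2 M$ over all $k,M\ge1$ for which there are $M$ input states of $\mathcal E^{\otimes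 k}$ whose outputs are identified with certainty by some measurement. The zero-error quantum capacity $Q_0(\mathcal E)$ is the supremum of $\frac1k\log_2 K$ over all $k,K\ge1$ for which there are an encoding channel $\mathcal C$ from $M_K(\mathbb C)$ to the input algebra of $\mathcal E^{\otimes k}$ and a decoding channel $\mathcal D$ from its output algebra to $M_K(\mathbb C)$ with $\mathcal D\circ\mathcal E^{\otimes k}\circ\mathcal C=\mathrm{id}$. **Theorem.** Suppose there is a subspace $S\subseteq\mathcal H_A\otimes\mathcal H_A$ such that 1. $S$ is strongly unextendible; 2. $S^\perp$ is strongly unextendible; 3. $\mathbb F(S)=S$; 4. $\mathbb F\big((\mathbb 1\otimes X)S\big)=(\mathbb 1\otimes X)S$; 5. $\mathbb M(S)$ is the linear span of a set of positive semidefinite matrices; 6. $\mathbb M\big((\mathbb 1\otimes X)S^\perp\big)$ is the linear span of a set of positive semidefinite matrices; 7. $S\perp\big((\mathbb 1+X)\otimes(\mathbb 1-X)\big)S^\perp$. Then there exist channels $\mathcal E_1,\mathcal E_2$ with input space $\mathcal H_A$ (and finite-dimensional output spaces) such that $$C_0(\mathcal E_1)=C_0(\mathcal E_2)=0\quad\text{and}\quad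 Q_0(\mathcal E_1\otimes\mathcal E_2)\ge 1 .$$ -/

import Mathlib

open scoped Kronecker ComplexOrder

noncomputable section

namespace ZeroError

/-! ## Bipartite vectors

`H_A = ℂ^d` is `EuclideanSpace ℂ (Fin d)`, its tensor power `H_A^{⊗k}` is
`EuclideanSpace ℂ (Fin k → Fin d)`, and a bipartite space `ℂ^n ⊗ ℂ^n` is
`EuclideanSpace ℂ (n × n)`, all in the product basis. -/

/-- The product vector `ψ ⊗ φ`. -/
def prodVec {n : Type*} (ψ φ : EuclideanSpace ℂ n) : EuclideanSpace ℂ (n × n) :=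
  WithLp.toLp 2 fun p => ψ p.1 * φ p.2

/-- The vector `s₁ ⊗ ⋯ ⊗ s_k` of `(H_A ⊗ H_A)^{⊗k}`, regarded as a vector of
`H_A^{⊗k} ⊗ H_A^{⊗k}` by collecting all the first and all the second tensor factors. -/
def tensorVec {n : Type*} {k : ℕ} (s : Fin k → EuclideanSpace ℂ (n × n)) :
    EuclideanSpace ℂ ((Fin k → n) × (Fin k → n)) :=
  WithLp.toLp 2 fun p => ∏ i, s i (p.1 i, p.2 i)

/-- The tensor power `S^{⊗k}`, a subspace of `H_A^{⊗k} ⊗ H_A^{⊗k}`. -/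
def tensorPow {n : Type*} (k : ℕ) (S : Submodule ℂ (EuclideanSpace ℂ (n × n))) :
    Submodule ℂ (EuclideanSpace ℂ ((Fin k → n) × (Fin k → n))) :=
  Submodule.span ℂ {v | ∃ s : Fin k → EuclideanSpace ℂ (n × n),
    (∀ i, s i ∈ S) ∧ v = tensorVec s}

/-- `S` is strongly unextendible: for every `k ≥ 1` the orthogonal complement of `S^{⊗k}`
contains no product state. -/
def StronglyUnextendible {n : Type*} [Fintype n]
    (S : Submodule ℂ (EuclideanSpace ℂ (n × n))) : Prop :=
  ∀ k : ℕ, 1 ≤ k → ∀ ψ φ : EuclideanSpace ℂ (Fin k → n), ψ ≠ 0 → φ ≠ 0 →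
    prodVec ψ φ ∉ (tensorPow k S)ᗮ

/-- The flip `𝔽`: swap the two tensor factors and take the complex conjugate. -/
def flipVec {n : Type*} (ψ : EuclideanSpace ℂ (n × n)) : EuclideanSpace ℂ (n × n) :=
  WithLp.toLp 2 fun p => starRingEnd ℂ (ψ (p.2, p.1))

/-- The isomorphism `𝕄` from bipartite vectors to matrices,
`∑ M_{ij} |i⟩|j⟩ ↦ (M_{ij})`. -/
def matOf (n : Type*) : EuclideanSpace ℂ (n × n) →ₗ[ℂ] Matrix n n ℂ where
  toFun ψ := Matrix.of fun i j => ψ (i, j)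
  map_add' _ _ := rfl
  map_smul' _ _ := rfl

/-- The generalised Pauli `X`: ones on the anti-diagonal, zeros elsewhere. -/
def pauliX (d : ℕ) : Matrix (Fin d) (Fin d) ℂ :=
  Matrix.of fun i j => if j = Fin.rev i then 1 else 0

/-- The operator `A ⊗ B` on `ℂ^n ⊗ ℂ^n`. -/
def localOp {n : Type*} [Fintype n] [DecidableEq n] (A B : Matrix n n ℂ) :
    EuclideanSpace ℂ (n × n) →ₗ[ℂ] EuclideanSpace ℂ (n × n) :=
  Matrix.toEuclideanLin (A ⊗ₖ B)

/-- The matrix subspace `𝕄(S)` is spanned by positive semidefinite matrices. -/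
def SpannedByPSD {n : Type*} (S : Submodule ℂ (EuclideanSpace ℂ (n × n))) : Prop :=
  ∃ P : Set (Matrix n n ℂ), (∀ M ∈ P, M.PosSemidef) ∧ S.map (matOf n) = Submodule.span ℂ P

/-! ## Quantum channels -/

section Channels

variable {n m n' m' : Type*} [Fintype n] [DecidableEq n] [Fintype m] [DecidableEq m]
  [Fintype n'] [DecidableEq n'] [Fintype m'] [DecidableEq m']

/-- The map `id_k ⊗ Φ`, which applies `Φ` to each block of a `k × k` block matrix. -/
def ampliation (k : ℕ) (Φ : Matrix n n ℂ →ₗ[ℂ] Matrix m m ℂ)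
    (ρ : Matrix (Fin k × n) (Fin k × n) ℂ) : Matrix (Fin k × m) (Fin k × m) ℂ :=
  Matrix.of fun p q => Φ (Matrix.of fun x y => ρ (p.1, x) (q.1, y)) p.2 q.2

/-- A quantum channel: a completely positive trace-preserving linear map. -/
structure IsChannel (Φ : Matrix n n ℂ →ₗ[ℂ] Matrix m m ℂ) : Prop where
  completelyPositive : ∀ (k : ℕ) (ρ : Matrix (Fin k × n) (Fin k × n) ℂ),
    ρ.PosSemidef → (ampliation k Φ ρ).PosSemidef
  tracePreserving : ∀ ρ : Matrix n n ℂ, (Φ ρ).trace = ρ.trace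

/-- The tensor product `Φ ⊗ Ψ`, the linear map with `A ⊗ B ↦ Φ A ⊗ Ψ B`, written out on the
matrix units `|i⟩⟨j| ⊗ |i'⟩⟨j'|`. -/
def tensorMap (Φ : Matrix n n ℂ →ₗ[ℂ] Matrix m m ℂ) (Ψ : Matrix n' n' ℂ →ₗ[ℂ] Matrix m' m' ℂ) :
    Matrix (n × n') (n × n') ℂ →ₗ[ℂ] Matrix (m × m') (m × m') ℂ :=
  ∑ p : n × n', ∑ q : n × n',
    (Matrix.entryLinearMap ℂ ℂ p q).smulRight
      (Φ (Matrix.single p.1 q.1 1) ⊗ₖ Ψ (Matrix.single p.2 q.2 1))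

/-- The tensor power `Φ^{⊗k}`, the linear map with
`A₁ ⊗ ⋯ ⊗ A_k ↦ Φ A₁ ⊗ ⋯ ⊗ Φ A_k`, written out on the matrix units. -/
def tensorPowMap (k : ℕ) (Φ : Matrix n n ℂ →ₗ[ℂ] Matrix m m ℂ) :
    Matrix (Fin k → n) (Fin k → n) ℂ →ₗ[ℂ] Matrix (Fin k → m) (Fin k → m) ℂ :=
  ∑ x : Fin k → n, ∑ y : Fin k → n,
    (Matrix.entryLinearMap ℂ ℂ x y).smulRight
      (Matrix.of fun a b => ∏ i, Φ (Matrix.single (x i) (y i) 1) (a i) (b i))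

/-! ## Zero-error capacities -/

/-- `Φ` transmits `M` classical messages without error: there are input states
`ρ_1, …, ρ_M` and a measurement (POVM) on the output which identifies the message
with certainty. -/
def HasClassicalCode (Φ : Matrix n n ℂ →ₗ[ℂ] Matrix m m ℂ) (M : ℕ) : Prop :=
  ∃ (ρ : Fin M → Matrix n n ℂ) (T : Fin M → Matrix m m ℂ),
    (∀ i, (ρ i).PosSemidef ∧ (ρ i).trace = 1) ∧
    (∀ j, (T j).PosSemidef) ∧ ∑ j, T j = 1 ∧
    ∀ i j, (T j * Φ (ρ i)).trace = if i = j then 1 else 0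

/-- `Φ` transmits a `K`-dimensional quantum system without error: there are an encoding
channel and a decoding channel such that `decoding ∘ Φ ∘ encoding` is the identity. -/
def HasQuantumCode (Φ : Matrix n n ℂ →ₗ[ℂ] Matrix m m ℂ) (K : ℕ) : Prop :=
  ∃ (Enc : Matrix (Fin K) (Fin K) ℂ →ₗ[ℂ] Matrix n n ℂ)
    (Dec : Matrix m m ℂ →ₗ[ℂ] Matrix (Fin K) (Fin K) ℂ),
    IsChannel Enc ∧ IsChannel Dec ∧ Dec ∘ₗ Φ ∘ₗ Enc = LinearMap.id

/-- The zero-error classical capacity `C₀`: the supremum of `(log₂ M) / k` over all numbers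
`M` of messages that `k ≥ 1` uses of the channel transmit without error. -/
def classicalCapacity (Φ : Matrix n n ℂ →ₗ[ℂ] Matrix m m ℂ) : ENNReal :=
  ⨆ (k : ℕ) (M : ℕ) (_ : 1 ≤ k ∧ 1 ≤ M ∧ HasClassicalCode (tensorPowMap k Φ) M),
    ENNReal.ofReal (Real.logb 2 M / k)

/-- The zero-error quantum capacity `Q₀`: the supremum of `(log₂ K) / k` over all dimensions
`K` of quantum systems that `k ≥ 1` uses of the channel transmit without error. -/
def quantumCapacity (Φ : Matrix n n ℂ →ₗ[ℂ] Matrix m m ℂ) : ENNReal :=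
  ⨆ (k : ℕ) (K : ℕ) (_ : 1 ≤ k ∧ 1 ≤ K ∧ HasQuantumCode (tensorPowMap k Φ) K),
    ENNReal.ofReal (Real.logb 2 K / k)

end Channels

end ZeroError

end

open ZeroError

/-! Choose positive semidefinite families `M a` spanning `𝕄(S)` and `N b` spanning `𝕄((1 ⊗ X)Sᗮ) =
𝕄(Sᗮ)X`. After a congruence `A† M a A` making the sum equal to `1`, a family of this kind is `K a† K
a` for a channel whose Kraus operators have mutually orthogonal ranges
(`exists_kraus_of_posSemidef`). The first channel comes from `M`, the second from the transposes of
`N`.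

Two input vectors `ψ, φ` can be distinguished perfectly only if `ψ† K a† K b φ = 0` for all `a, b`.
On `k` copies, with the congruence absorbed into the vectors, this would put a product vector in the
complement of `S^{⊗k}` (or of `(Sᗮ)^{⊗k}`, since `X` is invertible and transposition only exchanges
and conjugates the vectors). Strong unextendibility excludes this, so both classical capacities
vanish.

Used together, the channels carry a qubit whose code is spanned, up to the inverse congruences, by
the vectors with coefficient matrices `1` and `X`. By `codeMatrix_sandwich` the Knill-Laflamme
conditions become conditions on `tr(W i† C W j T X)` with `C ∈ 𝕄(S)`, `T ∈ 𝕄(Sᗮ)`. The two flip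
symmetries give `tr(CT) = tr(XCXT) = 0`, which kills the off-diagonal terms; the last orthogonality
hypothesis then gives `tr(CXT) = tr(CTX)`, which equates the diagonal ones (`trace_code`). -/

namespace ZeroError

open Matrix

/-! ### Completely positive maps in Kraus form -/

section Kraus

variable {n m ι κ p : Type*} [Fintype n]

/-- The completely positive map with Kraus operators `K a`. -/
noncomputable def krausMap [Fintype ι] (K : ι → Matrix m n ℂ) :
    Matrix n n ℂ →ₗ[ℂ] Matrix m m ℂ where
  toFun ρ := ∑ a, K a * ρ * (K a)ᴴ
  map_add' x y := by simp [Matrix.mul_add, Matrix.add_mul, Finset.sum_add_distrib]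
  map_smul' c x := by simp [Finset.smul_sum]

theorem krausMap_apply [Fintype ι] (K : ι → Matrix m n ℂ) (ρ : Matrix n n ℂ) :
    krausMap K ρ = ∑ a, K a * ρ * (K a)ᴴ := rfl

theorem krausMap_apply_apply [Fintype ι] (K : ι → Matrix m n ℂ) (ρ : Matrix n n ℂ) (i j : m) :
    krausMap K ρ i j = ∑ x, ∑ y, ρ x y * ∑ a, K a i x * star (K a j y) := by
  simp only [krausMap_apply, Matrix.sum_apply, Matrix.mul_apply, Matrix.conjTranspose_apply,
    Finset.mul_sum, Finset.sum_mul]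
  rw [Finset.sum_comm, Finset.sum_comm' (t' := Finset.univ) (s' := fun _ => Finset.univ) (by simp)]
  rw [Finset.sum_comm]
  conv_rhs => rw [Finset.sum_comm]
  refine Finset.sum_congr rfl fun y _ => ?_
  rw [Finset.sum_comm]
  refine Finset.sum_congr rfl fun x _ => Finset.sum_congr rfl fun a _ => by ring

theorem krausMap_single [DecidableEq n] [Fintype ι] (K : ι → Matrix m n ℂ) (x y : n) (i j : m) :
    krausMap K (Matrix.single x y 1) i j = ∑ a, K a i x * star (K a j y) := by
  rw [krausMap_apply_apply]
  simp [Matrix.single_apply, ite_and]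

theorem krausMap_comp_krausMap [Fintype m] [Fintype ι] [Fintype κ] (L : κ → Matrix p m ℂ)
    (K : ι → Matrix m n ℂ) : krausMap L ∘ₗ krausMap K = krausMap fun a : κ × ι => L a.1 * K a.2 := by
  ext1 ρ
  simp only [LinearMap.comp_apply, krausMap_apply, Matrix.mul_sum, Matrix.sum_mul,
    Fintype.sum_prod_type, Matrix.conjTranspose_mul, Matrix.mul_assoc]

theorem isChannel_krausMap [Fintype m] [DecidableEq n] [DecidableEq m] [Fintype ι] (K : ι → Matrix m n ℂ)
    (hK : ∑ a, (K a)ᴴ * K a = 1) : IsChannel (krausMap K) where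
  completelyPositive k ρ hρ := by
    have : ampliation k (krausMap K) ρ =
        ∑ a, ((1 : Matrix (Fin k) (Fin k) ℂ) ⊗ₖ K a) * ρ * ((1 : Matrix (Fin k) (Fin k) ℂ) ⊗ₖ K a)ᴴ := by
      ext ⟨i, x⟩ ⟨j, y⟩
      simp [ampliation, krausMap_apply, Matrix.sum_apply, Matrix.mul_apply, Fintype.sum_prod_type,
        Matrix.one_apply, apply_ite, Finset.sum_mul, ite_mul]
    rw [this]
    exact Matrix.posSemidef_sum _ fun a _ => hρ.mul_mul_conjTranspose_same _
  tracePreserving ρ := by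
    rw [krausMap_apply, Matrix.trace_sum]
    calc ∑ a, (K a * ρ * (K a)ᴴ).trace = ∑ a, ((K a)ᴴ * K a * ρ).trace :=
          Finset.sum_congr rfl fun a _ => Matrix.trace_mul_cycle _ _ _
      _ = ρ.trace := by rw [← Matrix.trace_sum, ← Finset.sum_mul, hK, one_mul]

end Kraus

/-! ### Tensor products of matrices and of Kraus maps -/

section TensorMat

variable {n m p ι κ : Type*} {k : ℕ}

/-- The tensor product `A₁ ⊗ ⋯ ⊗ A_k` of matrices. -/
def tensorMat (A : Fin k → Matrix m n ℂ) : Matrix (Fin k → m) (Fin k → n) ℂ :=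
  Matrix.of fun x y => ∏ i, A i (x i) (y i)

theorem tensorMat_apply (A : Fin k → Matrix m n ℂ) (x : Fin k → m) (y : Fin k → n) :
    tensorMat A x y = ∏ i, A i (x i) (y i) := rfl

theorem tensorMat_mul [Fintype n] (A : Fin k → Matrix m n ℂ) (B : Fin k → Matrix n p ℂ) :
    tensorMat A * tensorMat B = tensorMat fun i => A i * B i := by
  ext x y
  simp only [Matrix.mul_apply, tensorMat_apply, Fintype.prod_sum, Finset.prod_mul_distrib]

theorem tensorMat_conjTranspose (A : Fin k → Matrix m n ℂ) :
    (tensorMat A)ᴴ = tensorMat fun i => (A i)ᴴ := by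
  ext x y
  simp [tensorMat_apply, Matrix.conjTranspose_apply]

theorem tensorMat_transpose (A : Fin k → Matrix m n ℂ) :
    (tensorMat A)ᵀ = tensorMat fun i => (A i)ᵀ := rfl

theorem tensorMat_one [DecidableEq n] :
    tensorMat (fun _ : Fin k => (1 : Matrix n n ℂ)) = 1 := by
  ext x y
  simp only [tensorMat_apply, Matrix.one_apply, Finset.prod_ite_zero, Finset.prod_const_one,
    Finset.mem_univ, true_implies, funext_iff]

theorem tensorMat_sum_smul [Fintype ι] (c : Fin k → ι → ℂ) (A : ι → Matrix m n ℂ) :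
    tensorMat (fun i => ∑ j, c i j • A j) =
      ∑ a : Fin k → ι, (∏ i, c i (a i)) • tensorMat fun i => A (a i) := by
  ext x y
  simp [tensorMat_apply, Matrix.sum_apply, Fintype.prod_sum, Finset.prod_mul_distrib]

variable [Fintype n] [DecidableEq n] [Fintype ι] [Fintype κ]

theorem tensorPowMap_krausMap (K : ι → Matrix m n ℂ) :
    tensorPowMap k (krausMap K) = krausMap fun a : Fin k → ι => tensorMat fun i => K (a i) := by
  ext1 ρ
  ext p q
  rw [krausMap_apply_apply]
  simp only [tensorPowMap, LinearMap.sum_apply, Matrix.sum_apply, LinearMap.smulRight_apply,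
    Matrix.smul_apply, Matrix.of_apply, krausMap_single, Matrix.entryLinearMap_apply, smul_eq_mul,
    Fintype.prod_sum, tensorMat_apply, Finset.prod_mul_distrib, star_prod]

theorem tensorMap_krausMap {n' m' : Type*} [Fintype n'] [DecidableEq n']
    (K : ι → Matrix m n ℂ) (L : κ → Matrix m' n' ℂ) :
    tensorMap (krausMap K) (krausMap L) = krausMap fun a : ι × κ => K a.1 ⊗ₖ L a.2 := by
  ext1 ρ
  ext p q
  rw [krausMap_apply_apply]
  simp only [tensorMap, LinearMap.sum_apply, Matrix.sum_apply, LinearMap.smulRight_apply,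
    Matrix.smul_apply, krausMap_single, Matrix.entryLinearMap_apply, smul_eq_mul,
    Matrix.kroneckerMap_apply, Finset.sum_mul_sum, Fintype.sum_prod_type, star_mul']
  refine Finset.sum_congr rfl fun _ _ => Finset.sum_congr rfl fun _ _ =>
    Finset.sum_congr rfl fun _ _ => Finset.sum_congr rfl fun _ _ => ?_
  congr 1
  refine Finset.sum_congr rfl fun _ _ => Finset.sum_congr rfl fun _ _ => by ring

end TensorMat

/-! ### Knill-Laflamme conditions and zero-error quantum codes -/

section QuantumCode

variable {n m ι : Type*} [Fintype n] [DecidableEq n] [Fintype m] [DecidableEq m] [Fintype ι]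
  [DecidableEq ι]

/-- The Knill-Laflamme criterion for a channel whose Kraus operators, restricted to the code,
have mutually orthogonal ranges and are multiples of isometries. -/
theorem hasQuantumCode_of_isometry {k : ℕ} [NeZero k] (K : ι → Matrix m n ℂ)
    (V : Matrix n (Fin k) ℂ) (c : ι → ℝ) (hc : ∀ a, 0 ≤ c a) (hV : Vᴴ * V = 1)
    (hsum : ∑ a, c a = 1)
    (h : ∀ a b, (K a * V)ᴴ * (K b * V) = if a = b then (c a : ℂ) • 1 else 0) :
    HasQuantumCode (krausMap K) k := by
  obtain ⟨G, hG⟩ : ∃ G : ι → Matrix m (Fin k) ℂ, ∀ a, K a * V = G a := ⟨_, fun _ => rfl⟩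
  simp only [hG] at h
  have hG0 : ∀ a, c a = 0 → G a = 0 := fun a ha => by
    rw [← Matrix.conjTranspose_mul_self_eq_zero, h]
    simp [ha]
  -- The orthogonal projection onto the sum of the ranges of the `G a`. Where `c a = 0` the inverse
  -- is `0` by convention, harmlessly, because then `G a = 0`.
  let P : Matrix m m ℂ := ∑ a, ((c a)⁻¹ : ℂ) • (G a * (G a)ᴴ)
  have hPG : ∀ b, P * G b = G b := fun b => by
    have : ∀ a, ((c a)⁻¹ : ℂ) • (G a * (G a)ᴴ) * G b = if a = b then G b else 0 := fun a => by
      rw [Matrix.smul_mul, Matrix.mul_assoc, h]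
      split_ifs with hab
      · subst hab
        by_cases ha : c a = 0
        · simp [hG0 a ha]
        · have : (c a : ℂ) ≠ 0 := by exact_mod_cast ha
          rw [Matrix.mul_smul, Matrix.mul_one, smul_smul, inv_mul_cancel₀ this, one_smul]
      · simp
    simp [P, Matrix.sum_mul, this]
  have hPh : Pᴴ = P := by
    simp [P, Matrix.conjTranspose_sum, Matrix.conjTranspose_smul, Matrix.conjTranspose_mul]
  have hPP : P * P = P := by
    conv_lhs => enter [2]; simp only [P]
    simp only [Matrix.mul_sum, Matrix.mul_smul, ← Matrix.mul_assoc, hPG]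
    rfl
  -- The decoder undoes each scaled isometry `G a` on its own range. The operators indexed by `m`
  -- send everything orthogonal to those ranges to a fixed basis state; they only make the map trace
  -- preserving.
  let D : ι ⊕ m → Matrix (Fin k) m ℂ :=
    Sum.elim (fun a => (((√(c a))⁻¹ : ℝ) : ℂ) • (G a)ᴴ)
      fun q => Matrix.single (0 : Fin k) q (1 : ℂ) * (1 - P)
  have hDl : ∀ a b, D (Sum.inl a) * G b = if a = b then ((√(c a) : ℝ) : ℂ) • 1 else 0 := fun a b => by
    simp only [D, Sum.elim_inl, Matrix.smul_mul, h]
    split_ifs with hab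
    · rw [smul_smul, ← Complex.ofReal_mul]
      congr 2
      rw [inv_mul_eq_div, Real.div_sqrt]
    · simp
  have hDr : ∀ q b, D (Sum.inr q) * G b = 0 := fun q b => by
    simp [D, Matrix.mul_assoc, Matrix.sub_mul, hPG]
  refine ⟨krausMap fun _ : Unit => V, krausMap D, isChannel_krausMap _ (by simpa using hV),
    isChannel_krausMap _ ?_, ?_⟩
  · have h1 : ∑ a, (D (Sum.inl a))ᴴ * D (Sum.inl a) = P := by
      refine Finset.sum_congr rfl fun a _ => ?_
      simp only [D, Sum.elim_inl, Matrix.conjTranspose_smul, Matrix.conjTranspose_conjTranspose,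
        Matrix.smul_mul, Matrix.mul_smul, smul_smul, Complex.star_def, Complex.conj_ofReal]
      rw [← Complex.ofReal_mul, ← mul_inv, Real.mul_self_sqrt (hc a), Complex.ofReal_inv]
    have h2 : ∑ q, (D (Sum.inr q))ᴴ * D (Sum.inr q) = 1 - P := by
      have : ∀ q, (D (Sum.inr q))ᴴ * D (Sum.inr q) = (1 - P) * Matrix.single q q 1 * (1 - P) :=
        fun q => by
          simp only [D, Sum.elim_inr, Matrix.conjTranspose_mul, Matrix.conjTranspose_sub, hPh,
            Matrix.conjTranspose_one, Matrix.mul_assoc, Matrix.conjTranspose_single]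
          rw [← Matrix.mul_assoc (Matrix.single q 0 _), Matrix.single_mul_single_same]
          simp
      simp_rw [this, ← Finset.sum_mul, ← Finset.mul_sum]
      have h1 : ∑ q : m, Matrix.single q q (1 : ℂ) = 1 := by
        ext i j
        simp [Matrix.sum_apply, Matrix.single_apply, Matrix.one_apply, ite_and]
      rw [h1]
      simp [Matrix.mul_sub, Matrix.sub_mul, hPP]
    rw [Fintype.sum_sum_type, h1, h2]
    abel
  · rw [krausMap_comp_krausMap, krausMap_comp_krausMap]
    ext1 ρ
    simp only [krausMap_apply, Fintype.sum_prod_type, Fintype.sum_sum_type, hDl, hDr,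
      hG, Fintype.sum_unique, Matrix.zero_mul, Finset.sum_const_zero, add_zero, LinearMap.id_apply]
    simp only [apply_ite, ite_mul, Matrix.zero_mul, Matrix.mul_zero, Matrix.conjTranspose_zero,
      ite_self, Finset.sum_ite_eq, Finset.mem_univ, if_true, Matrix.smul_mul, Matrix.one_mul,
      Matrix.conjTranspose_smul, Matrix.conjTranspose_one, Matrix.mul_smul, Matrix.mul_one, smul_smul,
      Complex.star_def, Complex.conj_ofReal, ← Complex.ofReal_mul]
    simp only [Real.mul_self_sqrt (hc _), ← Finset.sum_smul, ← Complex.ofReal_sum, hsum,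
      Complex.ofReal_one, one_smul]

/-- The Knill-Laflamme criterion without normalisation of the code. -/
theorem hasQuantumCode_of_knillLaflamme {k : ℕ} [NeZero k] (K : ι → Matrix m n ℂ)
    (hK : ∑ a, (K a)ᴴ * K a = 1) (V : Matrix n (Fin k) ℂ) (hV : V ≠ 0) (c : ι → ℂ)
    (h : ∀ a b, Vᴴ * ((K a)ᴴ * K b) * V = if a = b then c a • 1 else 0) :
    HasQuantumCode (krausMap K) k := by
  have hc : ∀ a, 0 ≤ c a := fun a => by
    have h1 := (Matrix.posSemidef_conjTranspose_mul_self (K a * V)).diag_nonneg (i := 0)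
    have h2 := h a a
    rw [Matrix.conjTranspose_mul, Matrix.mul_assoc, ← Matrix.mul_assoc _ _ V, ← Matrix.mul_assoc, h2] at h1
    simpa using h1
  have hcr : ∀ a, ((c a).re : ℂ) = c a := fun a => (Complex.eq_re_of_ofReal_le (hc a)).symm
  -- Summing the diagonal conditions against `∑ K a† K a = 1` shows that `V† V` is a scalar. The
  -- columns of `V` are thus automatically orthogonal and of equal norm, so `V ≠ 0` is the only
  -- nondegeneracy needed.
  have hVV : Vᴴ * V = ((∑ a, (c a).re : ℝ) : ℂ) • 1 := by
    calc Vᴴ * V = ∑ a, Vᴴ * ((K a)ᴴ * K a) * V := by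
          rw [← Matrix.sum_mul, ← Matrix.mul_sum, hK, Matrix.mul_one]
      _ = _ := by simp [h, hcr, Finset.sum_smul]
  set s := ∑ a, (c a).re
  have hs0 : 0 ≤ s := Finset.sum_nonneg fun a _ => (Complex.le_def.1 (hc a)).1
  have hs : s ≠ 0 := fun hs => hV <| by
    rw [← Matrix.conjTranspose_mul_self_eq_zero, hVV, hs]
    simp
  have hss : (((√s)⁻¹ : ℝ) : ℂ) * (((√s)⁻¹ : ℝ) : ℂ) = ((s⁻¹ : ℝ) : ℂ) := by
    rw [← Complex.ofReal_mul, ← mul_inv, Real.mul_self_sqrt hs0]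
  refine hasQuantumCode_of_isometry K ((((√s)⁻¹ : ℝ) : ℂ) • V) (fun a => s⁻¹ * (c a).re)
    (fun a => mul_nonneg (inv_nonneg.2 hs0) (Complex.le_def.1 (hc a)).1) ?_ ?_ fun a b => ?_
  · rw [Matrix.conjTranspose_smul, Complex.star_def, Complex.conj_ofReal, Matrix.smul_mul,
      Matrix.mul_smul, smul_smul, hss, hVV, smul_smul, ← Complex.ofReal_mul, inv_mul_cancel₀ hs,
      Complex.ofReal_one, one_smul]
  · rw [← Finset.mul_sum]
    exact inv_mul_cancel₀ hs
  · have := h a b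
    simp only [Matrix.mul_assoc] at this
    simp only [Matrix.conjTranspose_smul, Complex.star_def, Complex.conj_ofReal, Matrix.smul_mul,
      Matrix.mul_smul, smul_smul, hss, Matrix.conjTranspose_mul, Matrix.mul_assoc, this]
    split_ifs
    · rw [smul_smul, Complex.ofReal_mul, hcr]
    · simp

theorem one_le_quantumCapacity {n m : Type*} [Fintype n] [DecidableEq n] [Fintype m]
    [DecidableEq m] {Φ : Matrix n n ℂ →ₗ[ℂ] Matrix m m ℂ}
    (h : HasQuantumCode (tensorPowMap 1 Φ) 2) : 1 ≤ quantumCapacity Φ := by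
  unfold quantumCapacity
  refine le_trans ?_ (le_iSup₂_of_le 1 2 (le_iSup_of_le ⟨le_rfl, one_le_two, h⟩ le_rfl))
  simp

theorem tensorMat_fin_one {n m : Type*} (A : Fin 1 → Matrix m n ℂ) :
    tensorMat A = (A 0).submatrix (fun x => x 0) fun y => y 0 := by
  ext x y
  simp [tensorMat_apply]

/-- A single use of the channel suffices. The work is the transport along the bijection between `Fin
1 → n` and `n`. -/
theorem one_le_quantumCapacity_of_knillLaflamme (K : ι → Matrix m n ℂ)
    (hK : ∑ a, (K a)ᴴ * K a = 1) (V : Matrix n (Fin 2) ℂ) (hV : V ≠ 0) (c : ι → ℂ)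
    (h : ∀ a b, Vᴴ * ((K a)ᴴ * K b) * V = if a = b then c a • 1 else 0) :
    1 ≤ quantumCapacity (krausMap K) := by
  refine one_le_quantumCapacity ?_
  rw [tensorPowMap_krausMap]
  have e : Function.Bijective fun x : Fin 1 → n => x 0 := (Equiv.funUnique (Fin 1) n).bijective
  have key : ∀ a b : Fin 1 → ι, (tensorMat fun i => K (a i))ᴴ * (tensorMat fun i => K (b i)) =
      ((K (a 0))ᴴ * K (b 0)).submatrix (fun x : Fin 1 → n => x 0) fun y => y 0 := fun a b => by
    rw [tensorMat_conjTranspose, tensorMat_mul, tensorMat_fin_one]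
  refine hasQuantumCode_of_knillLaflamme _ ?_ (V.submatrix (fun x : Fin 1 → n => x 0) id) ?_
    (fun a => c (a 0)) fun a b => ?_
  · simp only [key]
    rw [← (Equiv.funUnique (Fin 1) ι).symm.sum_comp]
    ext x y
    have := congr_fun₂ hK (x 0) (y 0)
    simp only [Matrix.sum_apply] at this ⊢
    simpa [Matrix.one_apply, funext_iff] using this
  · intro h0
    refine hV ?_
    ext x y
    simpa using congr_fun₂ h0 (fun _ => x) y
  · rw [key, Matrix.conjTranspose_submatrix, Matrix.submatrix_mul _ _ _ _ _ e |>.symm,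
      Matrix.submatrix_mul _ _ _ _ _ e |>.symm, h, Matrix.submatrix_id_id]
    simp [funext_iff]

end QuantumCode

/-! ### Obstruction to zero-error classical codes -/

section ClassicalCode

variable {n m ι : Type*} [Fintype n] [DecidableEq n] [Fintype m] [DecidableEq m] [Fintype ι]

theorem exists_eq_mul_conjTranspose {A : Matrix n n ℂ} (hA : A.PosSemidef) :
    ∃ B : Matrix n n ℂ, A = B * Bᴴ := by
  open scoped MatrixOrder in
  exact CStarAlgebra.nonneg_iff_eq_mul_star_self.mp hA.nonneg

/-- If a measurement outcome `T` has probability zero on the output of `ρ`, then `T`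
annihilates the range of every Kraus operator on the support of `ρ`. -/
theorem mul_mul_eq_zero_of_trace_krausMap_eq_zero {n : Type*} [Fintype n]
    {K : ι → Matrix m n ℂ} {T : Matrix m m ℂ}
    (hT : T.PosSemidef) {Q : Matrix n n ℂ}
    (h : (T * krausMap K (Q * Qᴴ)).trace = 0) (a : ι) : T * K a * Q = 0 := by
  obtain ⟨R, rfl⟩ := exists_eq_mul_conjTranspose hT
  -- The probability is a sum over `a` of squared Hilbert-Schmidt norms, so each term vanishes.
  have h1 : ∀ a, (R * Rᴴ * (K a * (Q * Qᴴ) * (K a)ᴴ)).trace =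
      ((Rᴴ * K a * Q) * (Rᴴ * K a * Q)ᴴ).trace := fun a => by
    rw [Matrix.mul_assoc, Matrix.trace_mul_comm]
    simp [Matrix.mul_assoc]
  rw [krausMap_apply, Matrix.mul_sum, Matrix.trace_sum, Finset.sum_eq_zero_iff_of_nonneg] at h
  · have h2 := h a (Finset.mem_univ a)
    rw [h1, Matrix.trace_mul_conjTranspose_self_eq_zero_iff] at h2
    rw [Matrix.mul_assoc R, Matrix.mul_assoc R, h2, Matrix.mul_zero]
  · intro a _
    rw [h1]
    exact (Matrix.posSemidef_self_mul_conjTranspose _).trace_nonneg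

/-- Take vectors `Q u`, `R v` in the supports of two code states and insert `1 = ∑ T j` between `K
a†` and `K b`. The outcome `j = i₀` annihilates `K b R`, every other outcome annihilates `K a Q`, so
`Q† K a† K b R = 0` for the pair `a, b` on which the form is supposed not to vanish. -/
theorem not_hasClassicalCode {K : ι → Matrix m n ℂ} {M : ℕ} (hM : 2 ≤ M)
    (h : ∀ ψ φ : n → ℂ, ψ ≠ 0 → φ ≠ 0 → ∃ a b, star ψ ⬝ᵥ ((K a)ᴴ * K b) *ᵥ φ ≠ 0) :
    ¬ HasClassicalCode (krausMap K) M := by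
  rintro ⟨ρ, T, hρ, hT, hsum, hd⟩
  have hcol : ∀ i, ∃ Q : Matrix n n ℂ, ρ i = Q * Qᴴ ∧ ∃ u, Q *ᵥ u ≠ 0 := fun i => by
    obtain ⟨Q, hQ⟩ := exists_eq_mul_conjTranspose (hρ i).1
    refine ⟨Q, hQ, ?_⟩
    by_contra! hu
    have : Q = 0 := Matrix.mulVec_injective (funext fun u => by simp [hu])
    have := (hρ i).2
    simp_all
  have h01 : (⟨0, by omega⟩ : Fin M) ≠ ⟨1, by omega⟩ := by simp
  generalize (⟨0, by omega⟩ : Fin M) = i₀ at h01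
  generalize (⟨1, by omega⟩ : Fin M) = i₁ at h01
  obtain ⟨Q, hQ, u, hu⟩ := hcol i₀
  obtain ⟨R, hR, v, hv⟩ := hcol i₁
  obtain ⟨a, b, hab⟩ := h _ _ hu hv
  have hTR : T i₀ * K b * R = 0 :=
    mul_mul_eq_zero_of_trace_krausMap_eq_zero (hT _) (by rw [← hR, hd, if_neg h01.symm]) b
  have hTQ : ∀ j, j ≠ i₀ → T j * K a * Q = 0 := fun j hj =>
    mul_mul_eq_zero_of_trace_krausMap_eq_zero (hT _) (by rw [← hQ, hd, if_neg hj.symm]) a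
  refine hab ?_
  have hQR : Qᴴ * ((K a)ᴴ * K b) * R = 0 := by
    calc Qᴴ * ((K a)ᴴ * K b) * R = ∑ j, Qᴴ * (K a)ᴴ * T j * (K b * R) := by
          rw [← Matrix.sum_mul, ← Matrix.mul_sum, hsum]
          simp [Matrix.mul_assoc]
      _ = 0 := Finset.sum_eq_zero fun j _ => by
          by_cases hj : j = i₀
          · subst hj
            rw [Matrix.mul_assoc, ← Matrix.mul_assoc (T j), hTR, Matrix.mul_zero]
          · have := congr_arg Matrix.conjTranspose (hTQ j hj)
            simp only [Matrix.conjTranspose_mul, (hT j).isHermitian.eq,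
              Matrix.conjTranspose_zero] at this
            rw [Matrix.mul_assoc Qᴴ, this, Matrix.zero_mul]
  rw [Matrix.star_mulVec, Matrix.mulVec_mulVec, ← Matrix.dotProduct_mulVec, Matrix.mulVec_mulVec,
    ← Matrix.mul_assoc, hQR]
  simp

theorem classicalCapacity_krausMap_eq_zero {K : ι → Matrix m n ℂ}
    (h : ∀ k, 1 ≤ k → ∀ ψ φ : (Fin k → n) → ℂ, ψ ≠ 0 → φ ≠ 0 → ∃ a b : Fin k → ι,
      star ψ ⬝ᵥ (tensorMat fun i => (K (a i))ᴴ * K (b i)) *ᵥ φ ≠ 0) :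
    classicalCapacity (krausMap K) = 0 := by
  simp only [classicalCapacity, ENNReal.iSup_eq_zero]
  rintro k M ⟨hk, hM, hcode⟩
  obtain rfl | hM2 : M = 1 ∨ 2 ≤ M := by omega
  · simp
  · rw [tensorPowMap_krausMap] at hcode
    refine absurd hcode (not_hasClassicalCode hM2 fun ψ φ hψ hφ => ?_)
    simpa only [tensorMat_conjTranspose, tensorMat_mul] using h k hk ψ φ hψ hφ

end ClassicalCode

theorem matOf_apply {n : Type*} (s : EuclideanSpace ℂ (n × n)) (i j : n) :
    matOf n s i j = s (i, j) := rfl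

theorem matOf_flipVec {n : Type*} (s : EuclideanSpace ℂ (n × n)) :
    matOf n (flipVec s) = (matOf n s)ᴴ := rfl

/-! ### Strong unextendibility in terms of sesquilinear forms -/

section NonVanishing

variable {n ι : Type*} [Fintype n]

/-- No pair of nonzero vectors on any number of copies is annihilated by all the sesquilinear
forms given by tensor products of the matrices `M a`. -/
def NonVanishing (M : ι → Matrix n n ℂ) : Prop :=
  ∀ k : ℕ, 1 ≤ k → ∀ ψ φ : (Fin k → n) → ℂ, ψ ≠ 0 → φ ≠ 0 →
    ∃ a : Fin k → ι, star ψ ⬝ᵥ (tensorMat fun i => M (a i)) *ᵥ φ ≠ 0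

/-- The form of a transpose at `(ψ, φ)` is the original form at the conjugates of `(φ, ψ)`. -/
theorem NonVanishing.transpose {M : ι → Matrix n n ℂ} (h : NonVanishing M) :
    NonVanishing fun a => (M a)ᵀ := fun k hk ψ φ hψ hφ => by
  obtain ⟨a, ha⟩ := h k hk (star φ) (star ψ) (star_ne_zero.2 hφ) (star_ne_zero.2 hψ)
  refine ⟨a, ?_⟩
  rw [← tensorMat_transpose, Matrix.mulVec_transpose, dotProduct_comm, ← Matrix.dotProduct_mulVec]
  simpa using ha

/-- If the sum had a nonzero null vector `v`, each nonnegative term `v† M a v` would vanish,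
contradicting the case `k = 1`, `ψ = φ = v`. -/
theorem NonVanishing.posDef_sum [Fintype ι] {M : ι → Matrix n n ℂ} (h : NonVanishing M)
    (hM : ∀ a, (M a).PosSemidef) : (∑ a, M a).PosDef := by
  have hpos := Matrix.posSemidef_sum Finset.univ fun a _ => hM a
  refine Matrix.PosDef.of_dotProduct_mulVec_pos hpos.isHermitian fun v hv => ?_
  refine lt_of_le_of_ne (hpos.dotProduct_mulVec_nonneg v) fun h0 => ?_
  rw [Matrix.sum_mulVec, dotProduct_sum, eq_comm,
    Finset.sum_eq_zero_iff_of_nonneg fun a _ => (hM a).dotProduct_mulVec_nonneg v] at h0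
  let w : (Fin 1 → n) → ℂ := fun x => v (x 0)
  have hw : w ≠ 0 := fun hw => hv (funext fun i => congr_fun hw fun _ => i)
  obtain ⟨a, ha⟩ := h 1 le_rfl w w hw hw
  refine ha ?_
  rw [tensorMat_fin_one, ← h0 (a 0) (Finset.mem_univ _)]
  simp only [dotProduct, Matrix.mulVec, Matrix.submatrix_apply, Pi.star_apply, w]
  rw [← (Equiv.funUnique (Fin 1) n).symm.sum_comp]
  refine Finset.sum_congr rfl fun x _ => ?_
  rw [← (Equiv.funUnique (Fin 1) n).symm.sum_comp]
  rfl

theorem NonVanishing.conj [DecidableEq n] {M : ι → Matrix n n ℂ} (h : NonVanishing M)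
    {A A' : Matrix n n ℂ}
    (hA : A' * A = 1) : NonVanishing fun a => Aᴴ * M a * A := fun k hk ψ φ hψ hφ => by
  have hinj : ∀ χ : (Fin k → n) → ℂ, χ ≠ 0 → (tensorMat fun _ : Fin k => A) *ᵥ χ ≠ 0 := fun χ hχ h0 => by
    refine hχ ?_
    have := congr_arg (Matrix.mulVec (tensorMat fun _ : Fin k => A')) h0
    simpa [Matrix.mulVec_mulVec, tensorMat_mul, hA, tensorMat_one] using this
  obtain ⟨a, ha⟩ := h k hk _ _ (hinj ψ hψ) (hinj φ hφ)
  refine ⟨a, ?_⟩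
  rw [Matrix.star_mulVec, ← Matrix.dotProduct_mulVec, Matrix.mulVec_mulVec, Matrix.mulVec_mulVec,
    tensorMat_conjTranspose, tensorMat_mul, tensorMat_mul] at ha
  exact ha

theorem inner_tensorVec_prodVec {k : ℕ} (s : Fin k → EuclideanSpace ℂ (n × n))
    (ψ φ : (Fin k → n) → ℂ) :
    inner ℂ (tensorVec s) (prodVec (WithLp.toLp 2 ψ) (WithLp.toLp 2 (star φ))) =
      star (star ψ ⬝ᵥ (tensorMat fun i => matOf n (s i)) *ᵥ φ) := by
  rw [EuclideanSpace.inner_eq_star_dotProduct]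
  simp only [dotProduct, Matrix.mulVec, Fintype.sum_prod_type, tensorVec, prodVec, Finset.mul_sum,
    star_sum, Pi.star_apply, tensorMat_apply, matOf_apply, star_mul', star_star]
  refine Finset.sum_congr rfl fun x _ => Finset.sum_congr rfl fun y _ => by ring

/-- If all the forms vanished at `(ψ, φ)`, then by multilinear expansion `ψ ⊗ conj(Y^{⊗k} φ)` would
be orthogonal to `S^{⊗k}`; the conjugate turns the bilinear product vector into a sesquilinear
pairing. The left inverse of `Y` keeps the second factor nonzero. The factor `Y` accommodates both
`𝕄(S)` (`Y = 1`) and `𝕄(Sᗮ)X` (`Y = X`). -/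
theorem StronglyUnextendible.nonVanishing [DecidableEq n] [Fintype ι]
    {S : Submodule ℂ (EuclideanSpace ℂ (n × n))}
    (hS : StronglyUnextendible S) {Y Y' : Matrix n n ℂ} (hY : Y' * Y = 1) {M : ι → Matrix n n ℂ}
    (hM : ∀ s ∈ S, matOf n s * Y ∈ Submodule.span ℂ (Set.range M)) : NonVanishing M := by
  intro k hk ψ φ hψ hφ
  by_contra! h
  have hφ' : (tensorMat fun _ : Fin k => Y) *ᵥ φ ≠ 0 := fun h0 => by
    refine hφ ?_
    have := congr_arg (Matrix.mulVec (tensorMat fun _ : Fin k => Y')) h0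
    simpa [Matrix.mulVec_mulVec, tensorMat_mul, hY, tensorMat_one] using this
  refine hS k hk (WithLp.toLp 2 ψ)
    (WithLp.toLp 2 (star ((tensorMat fun _ : Fin k => Y) *ᵥ φ))) (by simpa using hψ)
    (by simpa using hφ') ?_
  rw [Submodule.mem_orthogonal]
  intro u hu
  induction hu using Submodule.span_induction with
  | mem u hu =>
    obtain ⟨s, hs, rfl⟩ := hu
    choose c hc using fun i => (Submodule.mem_span_range_iff_exists_fun ℂ).1 (hM (s i) (hs i))
    rw [inner_tensorVec_prodVec, Matrix.mulVec_mulVec, tensorMat_mul]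
    simp_rw [← hc]
    rw [tensorMat_sum_smul, Matrix.sum_mulVec, dotProduct_sum]
    simp [Matrix.smul_mulVec, h]
  | zero => simp
  | add x y _ _ hx hy => rw [inner_add_left, hx, hy, add_zero]
  | smul c x _ hx => rw [inner_smul_left, hx, mul_zero]

end NonVanishing

/-! ### Channels from positive semidefinite families, and codes for their products -/

theorem SpannedByPSD.exists_fin {n : Type*} [Fintype n] {S : Submodule ℂ (EuclideanSpace ℂ (n × n))}
    (hS : SpannedByPSD S) : ∃ (r : ℕ) (M : Fin r → Matrix n n ℂ), (∀ a, (M a).PosSemidef) ∧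
      S.map (matOf n) = Submodule.span ℂ (Set.range M) := by
  obtain ⟨P, hP, hSP⟩ := hS
  obtain ⟨t, ht, hspan⟩ :=
    (Submodule.fg_span_iff_fg_span_finset_subset P).1 (IsNoetherian.noetherian (R := ℂ) (M := Matrix n n ℂ) _)
  refine ⟨t.card, fun i => (t.equivFin.symm i : Matrix n n ℂ), fun a => hP _ (ht (t.equivFin.symm a).2), ?_⟩
  rw [hSP, hspan]
  congr 1
  ext x
  simp only [Set.mem_range]
  exact ⟨fun hx => ⟨t.equivFin ⟨x, hx⟩, by simp⟩, by rintro ⟨y, rfl⟩; exact (t.equivFin.symm y).2⟩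

/-- A family of positive semidefinite matrices with invertible sum is, up to a congruence, the
family `Kₐ† Kₐ` of a channel whose Kraus operators have mutually orthogonal ranges. -/
theorem exists_kraus_of_posSemidef {n : Type*} [Fintype n] [DecidableEq n] {r : ℕ}
    {M : Fin r → Matrix n n ℂ} (hM : ∀ a, (M a).PosSemidef) (hsum : (∑ a, M a).PosDef) :
    ∃ (m : ℕ) (K : Fin r → Matrix (Fin m) n ℂ) (A A' : Matrix n n ℂ),
      A' * A = 1 ∧ A * A' = 1 ∧ (∑ a, (K a)ᴴ * K a = 1) ∧
      ∀ a b, (K a)ᴴ * K b = if a = b then Aᴴ * M a * A else 0 := by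
  obtain ⟨B, hB⟩ := exists_eq_mul_conjTranspose hsum.posSemidef
  have hBu : IsUnit B := isUnit_of_mul_isUnit_left (hB ▸ hsum.isUnit)
  rw [Matrix.isUnit_iff_isUnit_det] at hBu
  choose R hR using fun a => exists_eq_mul_conjTranspose (hM a)
  let e := Fintype.equivFin (Fin r × n)
  -- With `∑ M a = B B†`, this choice gives `A† (∑ M a) A = 1`.
  let A := (B⁻¹)ᴴ
  have hBH : IsUnit Bᴴ.det := by rw [Matrix.det_conjTranspose]; exact hBu.star
  have hA : A = (Bᴴ)⁻¹ := Matrix.conjTranspose_nonsing_inv B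
  obtain ⟨F, hF⟩ : ∃ F : Fin r → Matrix n n ℂ, ∀ a, (R a)ᴴ * A = F a := ⟨_, fun _ => rfl⟩
  -- The output space consists of `r` orthogonal blocks, and `K a` places `F a = R a† A` in block
  -- `a`, so products with `a ≠ b` vanish.
  let K : Fin r → Matrix (Fin (Fintype.card (Fin r × n))) n ℂ := fun a =>
    Matrix.of fun i y => if (e.symm i).1 = a then F a (e.symm i).2 y else 0
  have hK : ∀ a b, (K a)ᴴ * K b = if a = b then Aᴴ * M a * A else 0 := fun a b => by
    have h1 : Aᴴ * M a * A = (F a)ᴴ * F a := by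
      rw [← hF, hR a, Matrix.conjTranspose_mul ((R a)ᴴ), Matrix.conjTranspose_conjTranspose (R a)]
      simp only [Matrix.mul_assoc]
    rw [h1]
    ext x y
    rw [Matrix.mul_apply, ← e.sum_comp, Fintype.sum_prod_type]
    by_cases hab : a = b
    · subst hab
      simp [K, Matrix.mul_apply, apply_ite]
    · simp only [K, Matrix.conjTranspose_apply, Matrix.of_apply, e.symm_apply_apply, if_neg hab, Matrix.zero_apply]
      refine Finset.sum_eq_zero fun l _ => Finset.sum_eq_zero fun z _ => ?_
      by_cases hl : l = a
      · simp [hl, hab]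
      · simp [hl]
  refine ⟨_, K, A, Bᴴ, by rw [hA, Matrix.mul_nonsing_inv _ hBH],
    by rw [hA, Matrix.nonsing_inv_mul _ hBH], ?_, hK⟩
  simp only [hK, if_true]
  rw [← Matrix.sum_mul, ← Matrix.mul_sum, hB, ← Matrix.mul_assoc, Matrix.mul_assoc _ Bᴴ, hA,
    Matrix.mul_nonsing_inv _ hBH, Matrix.mul_one, Matrix.conjTranspose_nonsing_inv,
    Matrix.conjTranspose_conjTranspose, Matrix.nonsing_inv_mul _ hBu]

theorem classicalCapacity_eq_zero_of_nonVanishing {n m ι : Type*} [Fintype n] [DecidableEq n]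
    [Fintype m] [DecidableEq m] [Fintype ι] [DecidableEq ι] {K : ι → Matrix m n ℂ} {M : ι → Matrix n n ℂ}
    {A A' : Matrix n n ℂ} (hA : A' * A = 1) (hM : NonVanishing M)
    (hK : ∀ a b, (K a)ᴴ * K b = if a = b then Aᴴ * M a * A else 0) :
    classicalCapacity (krausMap K) = 0 :=
  classicalCapacity_krausMap_eq_zero fun k hk ψ φ hψ hφ => by
    obtain ⟨a, ha⟩ := hM.conj hA k hk ψ φ hψ hφ
    exact ⟨a, a, by simpa [hK] using ha⟩

/-- The matrix whose columns are the bipartite vectors with coefficient matrices `W i`. -/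
def codeMatrix {n : Type*} {k : ℕ} (W : Fin k → Matrix n n ℂ) : Matrix (n × n) (Fin k) ℂ :=
  Matrix.of fun p i => W i p.1 p.2

/-- The transpose falling on `D` is why the second channel is built from the transposes of the `N
b`. -/
theorem codeMatrix_sandwich {n : Type*} [Fintype n] {k : ℕ} (W : Fin k → Matrix n n ℂ)
    (C D : Matrix n n ℂ) (i j : Fin k) :
    ((codeMatrix W)ᴴ * (C ⊗ₖ D) * codeMatrix W) i j = ((W i)ᴴ * C * W j * Dᵀ).trace := by
  simp only [Matrix.mul_apply, codeMatrix, Matrix.trace, Matrix.diag, Matrix.conjTranspose_apply,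
    Matrix.of_apply, Matrix.kroneckerMap_apply, Matrix.transpose_apply, Fintype.sum_prod_type,
    Finset.sum_mul]
  calc _ = ∑ x', ∑ y', ∑ y, ∑ x, star (W i x y) * (C x x' * D y y') * W j x' y' :=
        Finset.sum_congr rfl fun _ _ => Finset.sum_congr rfl fun _ _ => Finset.sum_comm
    _ = ∑ x', ∑ y, ∑ y', ∑ x, star (W i x y) * (C x x' * D y y') * W j x' y' :=
        Finset.sum_congr rfl fun _ _ => Finset.sum_comm
    _ = ∑ y, ∑ x', ∑ y', ∑ x, star (W i x y) * (C x x' * D y y') * W j x' y' := Finset.sum_comm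
    _ = ∑ y, ∑ y', ∑ x', ∑ x, star (W i x y) * (C x x' * D y y') * W j x' y' :=
        Finset.sum_congr rfl fun _ _ => Finset.sum_comm
    _ = _ := by
        refine Finset.sum_congr rfl fun _ _ => Finset.sum_congr rfl fun _ _ =>
          Finset.sum_congr rfl fun _ _ => Finset.sum_congr rfl fun _ _ => by ring

/-- If the bipartite vectors with coefficient matrices `W 0` and `W 1` satisfy the Knill-Laflamme
conditions for the families `M` and `Nᵀ`, then the product of the two channels transmits a qubit. -/
theorem one_le_quantumCapacity_tensorMap {n m m' ι κ : Type*} [Fintype n] [DecidableEq n]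
    [Fintype m] [DecidableEq m] [Fintype m'] [DecidableEq m'] [Fintype ι] [DecidableEq ι]
    [Fintype κ] [DecidableEq κ] {K : ι → Matrix m n ℂ} {L : κ → Matrix m' n ℂ}
    {M : ι → Matrix n n ℂ} {N : κ → Matrix n n ℂ} {A A' B B' : Matrix n n ℂ}
    (hA : A * A' = 1) (hB : B * B' = 1)
    (hK1 : ∑ a, (K a)ᴴ * K a = 1) (hL1 : ∑ a, (L a)ᴴ * L a = 1)
    (hK : ∀ a b, (K a)ᴴ * K b = if a = b then Aᴴ * M a * A else 0)
    (hL : ∀ a b, (L a)ᴴ * L b = if a = b then Bᴴ * (N a)ᵀ * B else 0)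
    (W : Fin 2 → Matrix n n ℂ) (hW : W ≠ 0) (c : ι → κ → ℂ)
    (h : ∀ a b i j, ((W i)ᴴ * M a * W j * N b).trace = if i = j then c a b else 0) :
    1 ≤ quantumCapacity (tensorMap (krausMap K) (krausMap L)) := by
  have hAB : (A ⊗ₖ B) * (A' ⊗ₖ B') = 1 := by
    rw [← Matrix.mul_kronecker_mul, hA, hB, Matrix.one_kronecker_one]
  rw [tensorMap_krausMap]
  -- The factor `A' ⊗ B'` cancels the congruences built into the two channels.
  refine one_le_quantumCapacity_of_knillLaflamme _ ?_ ((A' ⊗ₖ B') * codeMatrix W) ?_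
    (fun a => c a.1 a.2) fun a b => ?_
  · simp only [Matrix.conjTranspose_kronecker, ← Matrix.mul_kronecker_mul, Fintype.sum_prod_type]
    rw [← Matrix.one_kronecker_one]
    nth_rw 1 [← hK1]
    rw [← hL1]
    ext x y
    simp [Matrix.sum_apply, Finset.sum_mul_sum]
  · intro h0
    refine hW ?_
    have : codeMatrix W = 0 := by
      rw [← Matrix.one_mul (codeMatrix W), ← hAB, Matrix.mul_assoc, h0, Matrix.mul_zero]
    ext i x y
    exact congr_fun₂ this (x, y) i
  · have key : (K a.1 ⊗ₖ L a.2)ᴴ * (K b.1 ⊗ₖ L b.2) = if a = b then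
        (A ⊗ₖ B)ᴴ * (M a.1 ⊗ₖ (N a.2)ᵀ) * (A ⊗ₖ B) else 0 := by
      rw [Matrix.conjTranspose_kronecker, ← Matrix.mul_kronecker_mul, hK, hL,
        Matrix.conjTranspose_kronecker, ← Matrix.mul_kronecker_mul, ← Matrix.mul_kronecker_mul]
      by_cases h1 : a.1 = b.1 <;> by_cases h2 : a.2 = b.2 <;> simp [Prod.ext_iff, h1, h2]
    rw [key]
    split_ifs
    · have : ((A' ⊗ₖ B') * codeMatrix W)ᴴ * ((A ⊗ₖ B)ᴴ * (M a.1 ⊗ₖ (N a.2)ᵀ) * (A ⊗ₖ B)) *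
          ((A' ⊗ₖ B') * codeMatrix W) =
          (codeMatrix W)ᴴ * ((A ⊗ₖ B) * (A' ⊗ₖ B'))ᴴ * (M a.1 ⊗ₖ (N a.2)ᵀ) *
            (((A ⊗ₖ B) * (A' ⊗ₖ B')) * codeMatrix W) := by
        simp only [Matrix.conjTranspose_mul, Matrix.mul_assoc]
      rw [this, hAB, Matrix.conjTranspose_one, Matrix.mul_one, Matrix.one_mul]
      ext i j
      rw [codeMatrix_sandwich, Matrix.transpose_transpose, h]
      simp [Matrix.one_apply]
    · simp

/-! ### The anti-diagonal matrix `X` -/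

section PauliX

variable {d : ℕ}

theorem pauliX_mul_self : pauliX d * pauliX d = 1 := by
  ext i j
  simp only [pauliX, Matrix.mul_apply, Matrix.of_apply, Matrix.one_apply, ite_mul, one_mul,
    zero_mul, Finset.sum_ite_eq', Finset.mem_univ, if_true, Fin.rev_rev, eq_comm (a := i)]

theorem pauliX_transpose : (pauliX d)ᵀ = pauliX d := by
  ext i j
  simp only [pauliX, Matrix.transpose_apply, Matrix.of_apply]
  exact if_congr ⟨fun h => by rw [h, Fin.rev_rev], fun h => by rw [h, Fin.rev_rev]⟩ rfl rfl

theorem pauliX_conjTranspose : (pauliX d)ᴴ = pauliX d := by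
  ext i j
  have := congr_fun₂ (pauliX_transpose (d := d)) i j
  rw [Matrix.transpose_apply] at this
  rw [Matrix.conjTranspose_apply, this]
  simp [pauliX, apply_ite]

end PauliX

/-! ### Orthogonality as trace identities -/

section MatOf

variable {n : Type*} [Fintype n]

theorem matOf_localOp [DecidableEq n] (A B : Matrix n n ℂ) (s : EuclideanSpace ℂ (n × n)) :
    matOf n (localOp A B s) = A * matOf n s * Bᵀ := by
  ext i j
  simp only [matOf_apply, localOp, Matrix.toEuclideanLin, Matrix.toLpLin_apply, Matrix.mulVec, dotProduct, Matrix.mul_apply,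
    Fintype.sum_prod_type, Matrix.kroneckerMap_apply, Matrix.transpose_apply, Finset.sum_mul]
  rw [Finset.sum_comm]
  exact Finset.sum_congr rfl fun _ _ => Finset.sum_congr rfl fun _ _ => by ring

theorem inner_eq_trace (s t : EuclideanSpace ℂ (n × n)) :
    inner ℂ s t = ((matOf n s)ᴴ * matOf n t).trace := by
  rw [EuclideanSpace.inner_eq_star_dotProduct, Matrix.trace_mul_comm]
  simp [dotProduct, Matrix.trace, Matrix.mul_apply, Fintype.sum_prod_type, matOf_apply]

/-- Flip invariance closes `𝕄(S)` under adjoints, so the adjoint in the Hilbert-Schmidt inner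
product can be dropped. -/
theorem trace_mul_eq_zero_of_flipVec {S T : Submodule ℂ (EuclideanSpace ℂ (n × n))}
    (hflip : flipVec '' (S : Set (EuclideanSpace ℂ (n × n))) = S) (hST : S ⟂ T)
    {s t : EuclideanSpace ℂ (n × n)} (hs : s ∈ S) (ht : t ∈ T) :
    (matOf n s * matOf n t).trace = 0 := by
  have hfs : flipVec s ∈ S := by
    rw [← SetLike.mem_coe, ← hflip]
    exact ⟨s, hs, rfl⟩
  have := hST.inner_eq hfs ht
  rwa [inner_eq_trace, matOf_flipVec, Matrix.conjTranspose_conjTranspose] at this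

end MatOf

/-- The matrices `1` and `X` span a code for the product of the two channels. -/
theorem trace_code {d : ℕ} {S : Submodule ℂ (EuclideanSpace ℂ (Fin d × Fin d))}
    (hflip : flipVec '' (S : Set (EuclideanSpace ℂ (Fin d × Fin d))) = S)
    (hflipX : flipVec '' (S.map (localOp 1 (pauliX d)) : Set (EuclideanSpace ℂ (Fin d × Fin d))) =
      S.map (localOp 1 (pauliX d)))
    (horth : S ⟂ Sᗮ.map (localOp (1 + pauliX d) (1 - pauliX d)))
    {s t : EuclideanSpace ℂ (Fin d × Fin d)} (hs : s ∈ S) (ht : t ∈ Sᗮ) (i j : Fin 2) :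
    ((![1, pauliX d] i)ᴴ * matOf _ s * ![1, pauliX d] j * (matOf _ t * pauliX d)).trace =
      if i = j then (matOf _ s * matOf _ t * pauliX d).trace else 0 := by
  set X := pauliX d
  have hXX : X * X = 1 := pauliX_mul_self
  have hXT : Xᵀ = X := pauliX_transpose
  have hXH : Xᴴ = X := pauliX_conjTranspose
  set C := matOf _ s with hC
  set T := matOf _ t
  have h0 : ∀ {s t}, s ∈ S → t ∈ Sᗮ → (matOf (Fin d) s * matOf _ t).trace = 0 := fun hs ht =>
    trace_mul_eq_zero_of_flipVec hflip (Submodule.isOrtho_orthogonal_right S) hs ht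
  have h1 : (C * T).trace = 0 := h0 hs ht
  -- Flip invariance of `(1 ⊗ X)S`, applied to `C† X`, gives `X C ∈ 𝕄(S)X`, that is, `X C X ∈ 𝕄(S)`.
  have h2 : (X * C * X * T).trace = 0 := by
    have hfs : flipVec s ∈ S := by
      rw [← SetLike.mem_coe, ← hflip]
      exact ⟨s, hs, rfl⟩
    have : flipVec (localOp 1 X (flipVec s)) ∈ S.map (localOp 1 X) := by
      rw [← SetLike.mem_coe, ← hflipX]
      exact ⟨_, Submodule.mem_map_of_mem hfs, rfl⟩
    obtain ⟨u, hu, hus⟩ := this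
    have := congr_arg (matOf (Fin d)) hus
    rw [matOf_flipVec, matOf_localOp, matOf_localOp, matOf_flipVec, hXT, Matrix.one_mul,
      Matrix.one_mul, Matrix.conjTranspose_mul, Matrix.conjTranspose_conjTranspose, hXH] at this
    rw [← this, Matrix.mul_assoc (matOf _ u), hXX, Matrix.mul_one]
    exact h0 hu ht
  -- Expanding `tr(C(1 + X)T(1 - X)) = 0`, the terms `tr(CT)` and `tr(CXTX)` vanish and the two
  -- cross terms must agree.
  have h3 : (C * X * T).trace = (C * T * X).trace := by
    have := trace_mul_eq_zero_of_flipVec hflip horth hs (Submodule.mem_map_of_mem ht)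
    rw [matOf_localOp, Matrix.transpose_sub, Matrix.transpose_one, hXT] at this
    have h4 : (C * X * T * X).trace = 0 := by
      rw [Matrix.trace_mul_comm, ← h2]
      simp only [Matrix.mul_assoc]
    have h5 : C * ((1 + X) * T * (1 - X)) = C * T + C * X * T - C * T * X - C * X * T * X := by
      noncomm_ring
    rw [← hC, h5, Matrix.trace_sub, Matrix.trace_sub, Matrix.trace_add, h1, h4] at this
    linear_combination this
  have h6 : (C * X * (T * X)).trace = 0 := by
    rw [← Matrix.mul_assoc, Matrix.trace_mul_comm, ← h2]
    simp only [Matrix.mul_assoc]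
  have h7 : (X * C * (T * X)).trace = 0 := by
    rw [Matrix.trace_mul_comm, Matrix.mul_assoc, ← Matrix.mul_assoc X, hXX, Matrix.one_mul,
      Matrix.trace_mul_comm, h1]
  have h8 : (X * C * X * (T * X)).trace = (C * T * X).trace := by
    rw [Matrix.trace_mul_comm, ← h3, Matrix.mul_assoc, Matrix.mul_assoc X C, ← Matrix.mul_assoc X X,
      hXX, Matrix.one_mul, Matrix.trace_mul_comm]
  fin_cases i <;> fin_cases j <;> simp [hXH, h6, h7, h8, ← Matrix.mul_assoc C T X]

end ZeroError

/-! ### Assembly of the two channels -/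

theorem mainTheorem2 (d : ℕ) (hd : 1 ≤ d)
    (S : Submodule ℂ (EuclideanSpace ℂ (Fin d × Fin d)))
    (hS : StronglyUnextendible S)
    (hSperp : StronglyUnextendible Sᗮ)
    (hflip : flipVec '' (S : Set (EuclideanSpace ℂ (Fin d × Fin d))) = S)
    (hflipX : flipVec '' (S.map (localOp 1 (pauliX d)) : Set (EuclideanSpace ℂ (Fin d × Fin d))) =
      S.map (localOp 1 (pauliX d)))
    (hpos : SpannedByPSD S)
    (hposX : SpannedByPSD (Sᗮ.map (localOp 1 (pauliX d))))
    (horth : S ⟂ Sᗮ.map (localOp (1 + pauliX d) (1 - pauliX d))) :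
    ∃ (m₁ m₂ : ℕ)
      (E₁ : Matrix (Fin d) (Fin d) ℂ →ₗ[ℂ] Matrix (Fin m₁) (Fin m₁) ℂ)
      (E₂ : Matrix (Fin d) (Fin d) ℂ →ₗ[ℂ] Matrix (Fin m₂) (Fin m₂) ℂ),
      IsChannel E₁ ∧ IsChannel E₂ ∧
      classicalCapacity E₁ = 0 ∧ classicalCapacity E₂ = 0 ∧
      1 ≤ quantumCapacity (tensorMap E₁ E₂) := by
  obtain ⟨r, M, hM, hMspan⟩ := hpos.exists_fin
  obtain ⟨q, N, hN, hNspan⟩ := hposX.exists_fin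
  have hMv : NonVanishing M := hS.nonVanishing (one_mul (1 : Matrix (Fin d) (Fin d) ℂ))
    fun s hs => by
      rw [← hMspan, mul_one]
      exact Submodule.mem_map_of_mem hs
  -- The `N b` span `𝕄(Sᗮ)X`; the factor `X` is its own inverse.
  have hNv : NonVanishing fun b => (N b).transpose :=
    (hSperp.nonVanishing (pauliX_mul_self (d := d)) fun t ht => by
      rw [← hNspan]
      refine ⟨_, Submodule.mem_map_of_mem ht, ?_⟩
      rw [matOf_localOp, pauliX_transpose, one_mul]).transpose
  have hNt : ∀ b, (N b).transpose.PosSemidef := fun b => (hN b).transpose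
  obtain ⟨m₁, K, A, A', hA, hA', hK1, hK⟩ := exists_kraus_of_posSemidef hM (hMv.posDef_sum hM)
  obtain ⟨m₂, L, B, B', hB, hB', hL1, hL⟩ := exists_kraus_of_posSemidef hNt (hNv.posDef_sum hNt)
  have hMmem : ∀ a, ∃ s ∈ S, matOf (Fin d) s = M a := fun a => by
    have : M a ∈ S.map (matOf (Fin d)) := hMspan ▸ Submodule.subset_span ⟨a, rfl⟩
    simpa using this
  have hNmem : ∀ b, ∃ t ∈ Sᗮ, matOf (Fin d) t * pauliX d = N b := fun b => by
    have : N b ∈ (Sᗮ.map (localOp 1 (pauliX d))).map (matOf (Fin d)) :=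
      hNspan ▸ Submodule.subset_span ⟨b, rfl⟩
    obtain ⟨_, ⟨t, ht, rfl⟩, htb⟩ := this
    exact ⟨t, ht, by rw [← htb, matOf_localOp, pauliX_transpose, one_mul]⟩
  choose s hs hsM using hMmem
  choose t ht htN using hNmem
  refine ⟨m₁, m₂, krausMap K, krausMap L, isChannel_krausMap K hK1, isChannel_krausMap L hL1,
    classicalCapacity_eq_zero_of_nonVanishing hA hMv hK,
    classicalCapacity_eq_zero_of_nonVanishing hB hNv hL,
    one_le_quantumCapacity_tensorMap hA' hB' hK1 hL1 hK hL ![1, pauliX d] (fun h0 => ?_)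
      (fun a b => (matOf _ (s a) * matOf _ (t b) * pauliX d).trace) fun a b i j => ?_⟩
  -- The code is nonzero because `d ≥ 1` makes the identity matrix nonzero.
  · have : (1 : Matrix (Fin d) (Fin d) ℂ) ⟨0, hd⟩ ⟨0, hd⟩ = 0 := by
      rw [show (1 : Matrix (Fin d) (Fin d) ℂ) = 0 from congr_fun h0 0]
      rfl
    simp at this
  · rw [← hsM, ← htN]
    exact trace_code hflip hflipX horth (hs a) (ht b) i j
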